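/- Let $G=(V,E)$ be a finite simple undirected graph. A set $D\subseteq V$ is a \emph{total dominating set} if every vertex $x\in V$ has a neighbour in $D$, and $C\subseteq V$ is a \emph{harmless set} if $V\setminus C$ is a total dominating set. The problem \textsc{Harmless Set} asks, for a given graph, for a harmless set of maximum cardinality. \textbf{Theorem.} \textsc{Harmless Set} is factor-$2$ polynomial-time approximable: there is a deterministic algorithm, running in time polynomial in the length of the input (on a Turing machine, with the graph given by its adjacency matrix), which on every finite simple graph $G$ that has a harmless set returns a harmless set $C$ of $G$ with $$2\,|C|\;\ge\;\max\{|C'| : C'\text{ is a harmless set of }G\},$$ and which on every other graph (that is, on every graph with an isolated vertex) reports that there is no harmless set. -/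

import Mathlib

/-! ### Maximization problems and polynomial-time approximation -/

/-- A maximization problem: instances, for each instance the candidate objects, which of them are
feasible solutions, and the value of each object. -/
structure MaxProblem where
  Inst : Type
  Obj : Inst → Type
  SOL : (x : Inst) → Set (Obj x)
  m : (x : Inst) → Obj x → ℕ

namespace MaxProblem

/-- `k` is the optimum value of the instance `x`: the maximum of the values of its feasible
solutions (in particular it is attained). -/
def IsOptValue (P : MaxProblem) (x : P.Inst) (k : ℕ) : Prop :=
  IsGreatest (P.m x '' P.SOL x) k

/-- `y` is an `α`-approximate solution for `x`: it is feasible and `α · m(x, y) ≥ m*(x)`. -/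
def IsApproxSolution (P : MaxProblem) (α : ℝ) (x : P.Inst) (y : P.Obj x) : Prop :=
  y ∈ P.SOL x ∧ ∃ k : ℕ, P.IsOptValue x k ∧ (k : ℝ) ≤ α * (P.m x y : ℝ)

/-- A representation of instances and objects by finite strings: instances over a finite alphabet
`Γ`, objects (given the instance) over the binary alphabet. -/
structure Coding (P : MaxProblem) where
  Γ : Type
  finΓ : Finite Γ
  encInst : P.Inst → List Γ
  encInst_injective : Function.Injective encInst
  encObj : (x : P.Inst) → P.Obj x → List Bool
  encObj_injective : ∀ x, Function.Injective (encObj x)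

/-- The string by which an algorithm answers: either the report that there is no solution, or a
flag followed by an object. -/
def Coding.encAnswer {P : MaxProblem} (C : P.Coding) (x : P.Inst) : Option (P.Obj x) → List Bool
  | none => [false]
  | some y => true :: C.encObj x y

/-- `P` is factor-`α` polynomial-time approximable (with respect to the coding `C`): some algorithm
`A` returns an `α`-approximate solution on every instance that has a feasible solution, reports on
all other instances that there is none, and is computed by a Turing machine whose number of steps
is bounded by a polynomial in the length of the input string. -/
def PolyTimeApproximable (P : MaxProblem) (C : P.Coding) (α : ℝ) : Prop :=
  ∃ A : (x : P.Inst) → Option (P.Obj x),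
    (∀ x, (P.SOL x).Nonempty → ∃ y, A x = some y ∧ P.IsApproxSolution α x y) ∧
    (∀ x, P.SOL x = ∅ → A x = none) ∧
    Nonempty (Turing.TM2ComputableInPolyTime C.encInst (id : List Bool → List Bool)
      (fun x => C.encAnswer x (A x)))

end MaxProblem

/-! ### Total dominating sets and harmless sets -/

/-- Every vertex (including those in `D`) has a neighbour in `D`. -/
def SimpleGraph.IsTotalDominatingSet {V : Type*} (G : SimpleGraph V) (D : Set V) : Prop :=
  ∀ x : V, ∃ y ∈ D, G.Adj x y

/-- A harmless set is the complement of a total dominating set. -/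
def SimpleGraph.IsHarmlessSet {V : Type*} (G : SimpleGraph V) (C : Set V) : Prop :=
  ∃ D : Set V, G.IsTotalDominatingSet D ∧ C = Dᶜ

/-- A finite simple undirected graph, given as its order `n` and a graph on `{0, …, n - 1}`. -/
abbrev FinGraph : Type := Σ n : ℕ, SimpleGraph (Fin n)

/-- The problem: given a graph, find a harmless set of maximum cardinality. -/
def harmlessSetProblem : MaxProblem where
  Inst := FinGraph
  Obj G := Finset (Fin G.1)
  SOL G := {C | G.2.IsHarmlessSet (C : Set (Fin G.1))}
  m _ C := C.card

/-! ### The coding: adjacency matrices and characteristic vectors -/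

/-- The row of the vertex `u` in the adjacency matrix, followed by an end-of-row marker `none`. -/
noncomputable def FinGraph.encodeRow (G : FinGraph) (u : Fin G.1) : List (Option Bool) :=
  open Classical in
  (List.finRange G.1).map (fun v => some (decide (G.2.Adj u v))) ++ [none]

/-- The adjacency matrix of a graph, written row by row. -/
noncomputable def FinGraph.encode (G : FinGraph) : List (Option Bool) :=
  (List.finRange G.1).flatMap G.encodeRow

/-- The characteristic vector of a set of vertices, as a string of `n` bits. -/
def encodeVertexSet {n : ℕ} (S : Finset (Fin n)) : List Bool :=
  (List.finRange n).map (fun v => decide (v ∈ S))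

theorem encodeVertexSet_injective {n : ℕ} :
    Function.Injective (encodeVertexSet : Finset (Fin n) → List Bool) := by
  intro S T h
  ext v
  have := List.map_inj_left.1 h v (List.mem_finRange v)
  simpa using this

theorem FinGraph.encodeRow_length (G : FinGraph) (u : Fin G.1) :
    (G.encodeRow u).length = G.1 + 1 := by
  simp [FinGraph.encodeRow]

theorem FinGraph.encode_length (G : FinGraph) : G.encode.length = G.1 * (G.1 + 1) := by
  simp [FinGraph.encode, List.length_flatMap, FinGraph.encodeRow_length]

theorem flatMap_congr_inv {α β : Type} (f g : α → List β) (hfg : ∀ a, (f a).length = (g a).length)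
    (l : List α) (h : l.flatMap f = l.flatMap g) : ∀ a ∈ l, f a = g a := by
  induction l with
  | nil => simp
  | cons b l ih =>
    rw [List.flatMap_cons, List.flatMap_cons] at h
    obtain ⟨h1, h2⟩ := List.append_inj h (hfg b)
    intro a ha
    rcases List.mem_cons.1 ha with rfl | ha
    · exact h1
    · exact ih h2 a ha

theorem FinGraph.encode_injective : Function.Injective FinGraph.encode := by
  rintro ⟨n, G⟩ ⟨k, H⟩ h
  have hl := congrArg List.length h
  rw [FinGraph.encode_length, FinGraph.encode_length] at hl
  have hnk : n = k := by
    change n * (n + 1) = k * (k + 1) at hl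
    nlinarith
  subst hnk
  congr 1
  ext u v
  have h1 := flatMap_congr_inv (FinGraph.encodeRow ⟨n, G⟩) (FinGraph.encodeRow ⟨n, H⟩)
    (fun a => by rw [FinGraph.encodeRow_length, FinGraph.encodeRow_length])
    (List.finRange n) h u (List.mem_finRange u)
  have h2 := List.map_inj_left.1 (List.append_cancel_right h1) v (List.mem_finRange v)
  simpa using h2

/-- Graphs are given by their adjacency matrices, vertex sets by their characteristic vectors. -/
noncomputable def harmlessSetCoding : harmlessSetProblem.Coding where
  Γ := Option Bool
  finΓ := inferInstance
  encInst := FinGraph.encode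
  encInst_injective := FinGraph.encode_injective
  encObj _ S := encodeVertexSet S
  encObj_injective _ := encodeVertexSet_injective

/-! ### The greedy algorithm

A pair `S` records the set `S.1` of vertices that have no chosen neighbour yet and the set `S.2` of
chosen vertices. A pass with threshold `t` chooses every vertex that has, when its turn comes, at
least `t` neighbours in `S.1`. The algorithm makes a pass with threshold `2`, then one with
threshold `1`, and answers with the complement of the set of chosen vertices. -/

/-! Let `n` be the number of vertices, and let the threshold-2 pass choose `p` vertices and leave a
set `U` without chosen neighbours. Each choice removes at least two vertices from the undominated
set, so `2p + |U| ≤ n`. No vertex has two neighbours in `U` any more, so distinct vertices of `U`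
need distinct dominators, and every total dominating set has at least `|U|` elements; hence every
harmless set has at most `n - |U|`. The threshold-1 pass adds at most `|U|` choices, so the
complement of the chosen set has size at least `n - p - |U|`, and `2(n - p - |U|) ≥ n - |U|`. A
vertex still undominated after that pass has no neighbour at all, which is the case without
solution. The ingredients are `greedyPass_weight_le`, `card_openNeighbors_greedyPass_lt` and
`card_le_of_isTotalDominatingSet`; they hold for every order of treatment.

For the running time, a vertex is treated using only its own matrix row and the current bit vector
of undominated vertices. A stack machine therefore needs one sweep over the row to count (up to 2)
and one sweep back to restore and update the vector. Stacks reverse order, so the second pass meets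
the rows last to first, and its output comes out in the original order. `runs_greedy` assembles the
run and its linear time bound. -/

namespace SimpleGraph

open scoped Classical in
/-- The neighbours of `v` that have no chosen neighbour yet. -/
noncomputable def openNeighbors {V : Type*} (G : SimpleGraph V) (U : Finset V) (v : V) :
    Finset V :=
  U.filter (G.Adj v)

section OpenNeighbors

variable {V : Type*} {G : SimpleGraph V}

theorem mem_openNeighbors {U : Finset V} {v w : V} :
    w ∈ G.openNeighbors U v ↔ w ∈ U ∧ G.Adj v w := by
  simp [openNeighbors]

theorem openNeighbors_subset (U : Finset V) (v : V) : G.openNeighbors U v ⊆ U := by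
  intro w hw
  exact (mem_openNeighbors.1 hw).1

theorem openNeighbors_mono {U U' : Finset V} (h : U ⊆ U') (v : V) :
    G.openNeighbors U v ⊆ G.openNeighbors U' v := by
  intro w hw
  rw [mem_openNeighbors] at *
  exact ⟨h hw.1, hw.2⟩

/-- A set that meets every neighbourhood in at most one vertex is at most as large as any total
dominating set. -/
theorem card_le_of_isTotalDominatingSet {U D : Finset V}
    (hU : ∀ v, (G.openNeighbors U v).card < 2) (hD : G.IsTotalDominatingSet (D : Set V)) :
    U.card ≤ D.card := by
  choose f hf hadj using hD
  refine Finset.card_le_card_of_injOn f (fun x _ => hf x) ?_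
  intro x hx y hy hxy
  have hle : (G.openNeighbors U (f x)).card ≤ 1 := Nat.lt_succ_iff.1 (hU (f x))
  refine Finset.card_le_one.1 hle x ?_ y ?_
  · exact mem_openNeighbors.2 ⟨hx, (hadj x).symm⟩
  · rw [hxy]
    exact mem_openNeighbors.2 ⟨hy, (hadj y).symm⟩

end OpenNeighbors

/-! ### Invariants of a greedy pass with arbitrary threshold and order. -/

section Greedy

variable {V : Type*} [DecidableEq V] (G : SimpleGraph V)

/-- Choose `v` if at least `t` of its neighbours have no chosen neighbour yet. -/
noncomputable def greedyStep (t : ℕ) (S : Finset V × Finset V) (v : V) : Finset V × Finset V :=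
  if t ≤ (G.openNeighbors S.1 v).card then (S.1 \ G.openNeighbors S.1 v, insert v S.2) else S

/-- Treat the vertices of a list in turn. -/
noncomputable def greedyPass (t : ℕ) (S : Finset V × Finset V) (l : List V) :
    Finset V × Finset V :=
  l.foldl (G.greedyStep t) S

@[simp]
theorem greedyPass_nil (t : ℕ) (S : Finset V × Finset V) : G.greedyPass t S [] = S := rfl

variable {G}

theorem greedyStep_fst_subset (t : ℕ) (S : Finset V × Finset V) (v : V) :
    (G.greedyStep t S v).1 ⊆ S.1 := by
  unfold greedyStep
  split_ifs
  · exact Finset.sdiff_subset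
  · exact Finset.Subset.refl _

theorem greedyPass_fst_subset (t : ℕ) (S : Finset V × Finset V) (l : List V) :
    (G.greedyPass t S l).1 ⊆ S.1 := by
  induction l generalizing S with
  | nil => exact Finset.Subset.refl _
  | cons v l ih => exact (ih _).trans (greedyStep_fst_subset t S v)

/-- A choice raises the first summand by at most `t` and removes at least `t` vertices from the
undominated set. -/
theorem greedyStep_weight_le (t : ℕ) (S : Finset V × Finset V) (v : V) :
    t * (G.greedyStep t S v).2.card + (G.greedyStep t S v).1.card ≤ t * S.2.card + S.1.card := by
  unfold greedyStep
  split_ifs with h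
  · have h1 := Finset.card_sdiff_add_card_eq_card (openNeighbors_subset (G := G) S.1 v)
    have h2 := Nat.mul_le_mul_left t (Finset.card_insert_le v S.2)
    rw [Nat.mul_add, Nat.mul_one] at h2
    dsimp only
    omega
  · exact le_rfl

/-- Each choice in a pass with threshold `t` uses up at least `t` vertices. -/
theorem greedyPass_weight_le (t : ℕ) (S : Finset V × Finset V) (l : List V) :
    t * (G.greedyPass t S l).2.card + (G.greedyPass t S l).1.card ≤
      t * S.2.card + S.1.card := by
  induction l generalizing S with
  | nil => exact le_rfl
  | cons v l ih => exact (ih _).trans (greedyStep_weight_le t S v)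

theorem card_openNeighbors_greedyStep_lt {t : ℕ} (ht : 0 < t) (S : Finset V × Finset V) (v : V) :
    (G.openNeighbors (G.greedyStep t S v).1 v).card < t := by
  unfold greedyStep
  split_ifs with h
  · rw [Finset.card_eq_zero.2]
    · exact ht
    · ext w
      simp only [mem_openNeighbors, Finset.mem_sdiff, Finset.notMem_empty, iff_false]
      tauto
  · omega

/-- The bound holds right after the turn of `v`, and the undominated set only shrinks afterwards. -/
theorem card_openNeighbors_greedyPass_lt {t : ℕ} (ht : 0 < t) (S : Finset V × Finset V)
    {l : List V} {v : V} (hv : v ∈ l) : (G.openNeighbors (G.greedyPass t S l).1 v).card < t := by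
  induction l generalizing S with
  | nil => simp at hv
  | cons a l ih =>
    rcases List.mem_cons.1 hv with rfl | hv
    · exact (Finset.card_le_card (openNeighbors_mono (greedyPass_fst_subset t _ l) v)).trans_lt
        (card_openNeighbors_greedyStep_lt ht S v)
    · exact ih _ hv

/-- Every vertex outside `S.1` has a neighbour in `S.2`. -/
def IsDominationState (G : SimpleGraph V) (S : Finset V × Finset V) : Prop :=
  ∀ w, w ∉ S.1 → ∃ v ∈ S.2, G.Adj w v

theorem IsDominationState.greedyStep {S : Finset V × Finset V} (h : G.IsDominationState S) (t : ℕ)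
    (v : V) : G.IsDominationState (G.greedyStep t S v) := by
  unfold SimpleGraph.greedyStep
  split_ifs
  · intro w hw
    by_cases hwU : w ∈ S.1
    · have : w ∈ G.openNeighbors S.1 v := by
        by_contra hn
        exact hw (Finset.mem_sdiff.2 ⟨hwU, hn⟩)
      exact ⟨v, Finset.mem_insert_self _ _, (mem_openNeighbors.1 this).2.symm⟩
    · obtain ⟨x, hx, hxw⟩ := h w hwU
      exact ⟨x, Finset.mem_insert_of_mem hx, hxw⟩
  · exact h

theorem IsDominationState.greedyPass {S : Finset V × Finset V} (h : G.IsDominationState S) (t : ℕ)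
    (l : List V) : G.IsDominationState (G.greedyPass t S l) := by
  induction l generalizing S with
  | nil => exact h
  | cons v l ih => exact ih (h.greedyStep t v)

end Greedy

/-! ### The two passes combined: feasibility and the factor 2. -/

section FiniteOrder

variable {n : ℕ} (G : SimpleGraph (Fin n))

/-- The state after the pass with threshold `2`. -/
noncomputable def greedyFirst : Finset (Fin n) × Finset (Fin n) :=
  G.greedyPass 2 (Finset.univ, ∅) (List.finRange n)

/-- The state after both passes. -/
noncomputable def greedyResult : Finset (Fin n) × Finset (Fin n) :=
  -- The reversed order is the one in which the machine finds the rows on its stack `saved`.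
  G.greedyPass 1 G.greedyFirst (List.finRange n).reverse

/-- The answer of the algorithm. -/
noncomputable def greedyAnswer : Option (Finset (Fin n)) :=
  if G.greedyResult.1 = ∅ then some (G.greedyResult.2)ᶜ else none

variable {G}

theorem isHarmlessSet_compl_iff {D : Finset (Fin n)} :
    G.IsHarmlessSet ((Dᶜ : Finset (Fin n)) : Set (Fin n)) ↔
      G.IsTotalDominatingSet (D : Set (Fin n)) := by
  constructor
  · rintro ⟨E, hE, h⟩
    rw [Finset.coe_compl, compl_inj_iff] at h
    rwa [h]
  · intro h
    exact ⟨D, h, by simp⟩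

theorem isHarmlessSet_greedyResult (h : G.greedyResult.1 = ∅) :
    G.IsHarmlessSet (((G.greedyResult.2)ᶜ : Finset (Fin n)) : Set (Fin n)) := by
  rw [isHarmlessSet_compl_iff]
  have h0 : G.IsDominationState ((Finset.univ, ∅) : Finset (Fin n) × Finset (Fin n)) :=
    fun w hw => absurd (Finset.mem_univ w) hw
  have := (h0.greedyPass 2 (List.finRange n)).greedyPass 1 (List.finRange n).reverse
  intro x
  exact this x (by
    change x ∉ G.greedyResult.1
    simp [h])

/-- If some total dominating set exists, an undominated `w` would have a neighbour `v`; but after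
the threshold-1 pass `v` has no undominated neighbour. -/
theorem greedyResult_fst_eq_empty {C : Set (Fin n)} (hC : G.IsHarmlessSet C) :
    G.greedyResult.1 = ∅ := by
  obtain ⟨D, hD, -⟩ := hC
  rw [Finset.eq_empty_iff_forall_notMem]
  intro w hw
  obtain ⟨v, -, hv⟩ := hD w
  have h1 : (G.openNeighbors G.greedyResult.1 v).card < 1 :=
    card_openNeighbors_greedyPass_lt one_pos G.greedyFirst (by simp)
  rw [Nat.lt_one_iff, Finset.card_eq_zero] at h1
  exact Finset.notMem_empty w (h1 ▸ mem_openNeighbors.2 ⟨hw, hv.symm⟩)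

theorem card_le_two_mul_card_greedyResult_compl {C : Finset (Fin n)}
    (hC : G.IsHarmlessSet (C : Set (Fin n))) : C.card ≤ 2 * ((G.greedyResult.2)ᶜ).card := by
  have h1 : 2 * G.greedyFirst.2.card + G.greedyFirst.1.card ≤ n := by
    simpa [greedyFirst] using greedyPass_weight_le (G := G) 2 (Finset.univ, ∅) (List.finRange n)
  have h2 : 1 * G.greedyResult.2.card + G.greedyResult.1.card ≤
      1 * G.greedyFirst.2.card + G.greedyFirst.1.card :=
    greedyPass_weight_le 1 G.greedyFirst (List.finRange n).reverse
  -- Lower bound on the optimal total dominating set, from the vertices left over by the first pass.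
  have h3 : G.greedyFirst.1.card ≤ (Cᶜ).card := by
    refine card_le_of_isTotalDominatingSet (G := G) (fun v => ?_) ?_
    · exact card_openNeighbors_greedyPass_lt two_pos _ (List.mem_finRange v)
    · rw [← isHarmlessSet_compl_iff, compl_compl]
      exact hC
  have h4 := Finset.card_add_card_compl C
  have h5 := Finset.card_add_card_compl G.greedyResult.2
  rw [Fintype.card_fin] at h4 h5
  omega

end FiniteOrder

end SimpleGraph

theorem isApproxSolution_greedyAnswer (G : FinGraph) (h : (harmlessSetProblem.SOL G).Nonempty) :
    ∃ C, G.2.greedyAnswer = some C ∧ harmlessSetProblem.IsApproxSolution 2 G C := by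
  obtain ⟨C, hC⟩ := h
  have h0 : G.2.greedyResult.1 = ∅ := SimpleGraph.greedyResult_fst_eq_empty hC
  refine ⟨(G.2.greedyResult.2)ᶜ, if_pos h0, SimpleGraph.isHarmlessSet_greedyResult h0, ?_⟩
  have hfin : (harmlessSetProblem.SOL G).Finite := Set.toFinite (α := Finset (Fin G.1)) _
  obtain ⟨M, hM, hmax⟩ := Set.exists_max_image _ (harmlessSetProblem.m G) hfin ⟨C, hC⟩
  refine ⟨harmlessSetProblem.m G M, ⟨⟨M, hM, rfl⟩, ?_⟩, ?_⟩
  · rintro _ ⟨C', hC', rfl⟩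
    exact hmax C' hC'
  · have : harmlessSetProblem.m G M ≤ 2 * ((G.2.greedyResult.2)ᶜ).card :=
      SimpleGraph.card_le_two_mul_card_greedyResult_compl hM
    exact_mod_cast this

theorem greedyAnswer_eq_none (G : FinGraph) (h : harmlessSetProblem.SOL G = ∅) :
    G.2.greedyAnswer = none := by
  refine if_neg fun h0 => ?_
  have : (G.2.greedyResult.2)ᶜ ∈ harmlessSetProblem.SOL G :=
    SimpleGraph.isHarmlessSet_greedyResult h0
  rw [h] at this
  exact this

/-! ### A stack machine for the greedy algorithm -/

namespace GreedyMachine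

open Turing Turing.TM2.Stmt

/-- The stacks: the input, the rows kept for the second pass, the vertices without chosen
neighbour, the row in progress, the choices of the first pass, and the output. -/
inductive Stack
  | input | saved | undominated | row | chosen | output
  deriving DecidableEq

instance : Fintype Stack :=
  ⟨{.input, .saved, .undominated, .row, .chosen, .output}, fun k => by cases k <;> simp⟩

/-- The stack alphabets. An entry of `row` holds a matrix entry and whether the vertex of its column
has no chosen neighbour yet. -/
@[reducible] def Alphabet : Stack → Type
  | .input => Option Bool
  | .saved => Option Bool
  | .undominated => Bool
  | .row => Bool × Bool
  | .chosen => Bool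
  | .output => Bool

/-- The labels; the argument says whether the machine is in the second pass. -/
inductive Label
  | scan (second : Bool) | unwind (second : Bool) | check | clear
  deriving Fintype

/-- The internal state: the symbol read from the input or from `saved`, the entries read from the
other stacks, and a counter that stops at `2`. -/
structure Register where
  symbol : Option (Option Bool)
  entry : Option (Bool × Bool)
  bit : Option Bool
  bit' : Option Bool
  count : Fin 3
  deriving Fintype

/-- The state of the registers between two loops. -/
def idle (c : Fin 3) : Register := ⟨none, none, none, none, c⟩

/-- The counter value that stands for `k`. -/
def saturate (k : ℕ) : Fin 3 := ⟨min k 2, by omega⟩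

/-- Whether the counter reaches the threshold of the pass. -/
def reaches (second : Bool) (c : Fin 3) : Bool :=
  bif second then decide (1 ≤ c.val) else decide (2 ≤ c.val)

abbrev Code := TM2.Stmt Alphabet Label Register

/-- The matrix entry last read. -/
def Register.matrixBit (s : Register) : Bool := (s.symbol.getD none).getD false

/-- Read one entry of a row and count it if it belongs to a vertex without chosen neighbour. -/
def scanEntry (second : Bool) : Code :=
  -- The stack is empty during the first row, before the number of vertices is known; the default
  -- `true` makes it stand for the full set.
  pop .undominated (fun s x => { s with bit := some (x.getD true) }) <|
  push .row (fun s => (s.matrixBit, s.bit.getD false)) <|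
  load (fun s => idle (bif s.matrixBit && s.bit.getD false then saturate (s.count.val + 1)
    else s.count)) <|
  goto fun _ => .scan second

/-- At the end of a row, the first pass copies the marker; the second one writes the output bit. -/
def endRow : Bool → Code
  | false => push .saved (fun _ => none) <| load (fun s => idle s.count) <|
      goto fun _ => .unwind false
  | true => pop .chosen (fun s x => { s with bit := x }) <|
      push .output (fun s => !(s.bit.getD false || reaches true s.count)) <|
      load (fun s => idle s.count) <| goto fun _ => .unwind true

/-- Read a symbol from the source of the pass. -/
def readSymbol : Bool → Code → Code
  | false => pop .input fun s x => { s with symbol := x }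
  | true => pop .saved fun s x => { s with symbol := x }

/-- The three branches correspond to a matrix entry, an end-of-row marker and an exhausted source.
-/
def scanCode (second : Bool) : Code :=
  readSymbol second <|
  branch (fun s => (s.symbol.getD none).isSome) (scanEntry second) <|
  branch (fun s => s.symbol.isSome) (endRow second) <|
  goto fun _ => bif second then .check else .scan true

/-- The first pass copies the matrix for the second one. -/
def saveEntry : Bool → Code → Code
  | false => push .saved fun s => some (s.entry.getD (false, false)).1
  | true => id

/-- The first pass keeps its choices for the second one. -/
def saveChoice : Bool → Code → Code
  | false => push .chosen fun s => reaches false s.count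
  | true => id

/-- Put a row back: the entries of the neighbours are cleared if the vertex has been chosen. -/
def unwindCode (second : Bool) : Code :=
  pop .row (fun s x => { s with entry := x }) <|
  branch (fun s => s.entry.isSome)
    (saveEntry second <|
      push .undominated (fun s => (s.entry.getD (false, false)).2 &&
        !((s.entry.getD (false, false)).1 && reaches second s.count)) <|
      load (fun s => idle s.count) <|
      goto fun _ => .unwind second)
    (saveChoice second <|
      load (fun _ => idle 0) <|
      goto fun _ => .scan second)

/-- A `true` bit is a vertex that stayed undominated, so the output must be discarded. Otherwise the
success flag goes on top of the finished characteristic vector. -/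
def checkCode : Code :=
  pop .undominated (fun s x => { s with bit := x }) <|
  branch (fun s => s.bit.isSome)
    (branch (fun s => s.bit.getD false)
      (load (fun _ => idle 0) <| goto fun _ => .clear)
      (load (fun _ => idle 0) <| goto fun _ => .check))
    (push .output (fun _ => true) <| load (fun _ => idle 0) halt)

/-- Both stacks are emptied in parallel, since a halting configuration may have nothing but the
answer on its stacks. -/
def clearCode : Code :=
  pop .undominated (fun s x => { s with bit := x }) <|
  pop .output (fun s x => { s with bit' := x }) <|
  branch (fun s => s.bit.isSome || s.bit'.isSome)
    (load (fun _ => idle 0) <| goto fun _ => .clear)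
    (push .output (fun _ => false) <| load (fun _ => idle 0) halt)

def program : Label → Code
  | .scan second => scanCode second
  | .unwind second => unwindCode second
  | .check => checkCode
  | .clear => clearCode

/-- The machine. -/
def machine : FinTM2 where
  K := Stack
  k₀ := .input
  k₁ := .output
  Γ := Alphabet
  Λ := Label
  main := .scan false
  σ := Register
  initialState := idle 0
  Γk₀Fin := inferInstanceAs (Fintype (Option Bool))
  m := program

/-- The stack contents, listed. -/
def contents (i s : List (Option Bool)) (u : List Bool) (r : List (Bool × Bool)) (c o : List Bool) :
    ∀ k, List (Alphabet k)
  | .input => i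
  | .saved => s
  | .undominated => u
  | .row => r
  | .chosen => c
  | .output => o

section Update

variable (i s : List (Option Bool)) (u : List Bool) (r : List (Bool × Bool)) (c o : List Bool)

theorem update_input (x : List (Option Bool)) :
    Function.update (contents i s u r c o) .input x = contents x s u r c o := by
  funext k
  cases k <;> simp [contents, Function.update]

theorem update_saved (x : List (Option Bool)) :
    Function.update (contents i s u r c o) .saved x = contents i x u r c o := by
  funext k
  cases k <;> simp [contents, Function.update]

theorem update_undominated (x : List Bool) :
    Function.update (contents i s u r c o) .undominated x = contents i s x r c o := by
  funext k
  cases k <;> simp [contents, Function.update]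

theorem update_row (x : List (Bool × Bool)) :
    Function.update (contents i s u r c o) .row x = contents i s u x c o := by
  funext k
  cases k <;> simp [contents, Function.update]

theorem update_chosen (x : List Bool) :
    Function.update (contents i s u r c o) .chosen x = contents i s u r x o := by
  funext k
  cases k <;> simp [contents, Function.update]

theorem update_output (x : List Bool) :
    Function.update (contents i s u r c o) .output x = contents i s u r c x := by
  funext k
  cases k <;> simp [contents, Function.update]

end Update

abbrev Config := TM2.Cfg Alphabet Label Register

/-- The machine goes from `a` to `b` in exactly `t` steps. -/
def Runs (t : ℕ) (a b : Config) : Prop :=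
  (flip bind (TM2.step program))^[t] (some a) = some b

theorem Runs.refl (a : Config) : Runs 0 a a := rfl

theorem Runs.trans {t t' : ℕ} {a b c : Config} (h : Runs t a b) (h' : Runs t' b c) :
    Runs (t + t') a c := by
  unfold Runs at *
  rw [Nat.add_comm, Function.iterate_add_apply, h, h']

theorem Runs.of_step {a b : Config} (h : TM2.step program a = some b) : Runs 1 a b := h

theorem Runs.head {t : ℕ} {a b c : Config} (h : TM2.step program a = some b) (h' : Runs t b c) :
    Runs (t + 1) a c := by
  rw [Nat.add_comm]
  exact (Runs.of_step h).trans h'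

/-- The configuration with the given label, counter and stack contents. -/
def config (l : Option Label) (k : Fin 3) (i s : List (Option Bool)) (u : List Bool)
    (r : List (Bool × Bool)) (c o : List Bool) : Config :=
  ⟨l, idle k, contents i s u r c o⟩

/-- A configuration in a pass: `x` is still to be read, and `y` is the other one of the stacks
`input` and `saved`. -/
def passConfig (second : Bool) (l : Label) (k : Fin 3) (x y : List (Option Bool)) (u : List Bool)
    (r : List (Bool × Bool)) (c o : List Bool) : Config :=
  config (some l) k (bif second then y else x) (bif second then x else y) u r c o

/-! ### Single transitions of the machine. -/

section Steps

variable (x y : List (Option Bool)) (u : List Bool) (r : List (Bool × Bool)) (c o : List Bool)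

theorem step_scan_entry (second : Bool) (k : Fin 3) (b : Bool) :
    TM2.step program (passConfig second (.scan second) k (some b :: x) y u r c o) =
      some (passConfig second (.scan second)
        (bif b && u.head?.getD true then saturate (k.val + 1) else k)
        x y u.tail ((b, u.head?.getD true) :: r) c o) := by
  cases second <;>
  simp [passConfig, config, program, scanCode, scanEntry, readSymbol, update_input, update_saved,
    update_undominated, update_row, contents, idle, Register.matrixBit]

theorem step_scan_marker_first (k : Fin 3) :
    TM2.step program (passConfig false (.scan false) k (none :: x) y u r c o) =
      some (passConfig false (.unwind false) k x (none :: y) u r c o) := by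
  simp [passConfig, config, program, scanCode, endRow, readSymbol, update_input, update_saved,
    contents, idle]

theorem step_scan_marker_second (k : Fin 3) (d : Bool) :
    TM2.step program (passConfig true (.scan true) k (none :: x) y u r (d :: c) o) =
      some (passConfig true (.unwind true) k x y u r c ((!(d || reaches true k)) :: o)) := by
  simp [passConfig, config, program, scanCode, endRow, readSymbol, update_saved, update_chosen,
    update_output, contents, idle]

/-- The saved copy becomes the source of the second pass, so the two stacks exchange roles in
`passConfig`. -/
theorem step_scan_nil_first :
    TM2.step program (passConfig false (.scan false) 0 [] y u r c o) =
      some (passConfig true (.scan true) 0 y [] u r c o) := by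
  simp [passConfig, config, program, scanCode, readSymbol, update_input, contents, idle]

theorem step_scan_nil_second :
    TM2.step program (passConfig true (.scan true) 0 [] y u r c o) =
      some (config (some .check) 0 y [] u r c o) := by
  simp [passConfig, config, program, scanCode, readSymbol, update_saved, contents, idle]

theorem step_unwind_cons (second : Bool) (k : Fin 3) (b a : Bool) :
    TM2.step program (passConfig second (.unwind second) k x y u ((b, a) :: r) c o) =
      some (passConfig second (.unwind second) k x (bif second then y else some b :: y)
        ((a && !(b && reaches second k)) :: u) r c o) := by
  cases second <;>
  simp [passConfig, config, program, unwindCode, saveEntry, update_saved, update_row,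
    update_undominated, contents, idle]

theorem step_unwind_nil (second : Bool) (k : Fin 3) :
    TM2.step program (passConfig second (.unwind second) k x y u [] c o) =
      some (passConfig second (.scan second) 0 x y u []
        (bif second then c else reaches false k :: c) o) := by
  cases second <;>
  simp [passConfig, config, program, unwindCode, saveChoice, update_chosen, update_row,
    contents, idle]

theorem step_check_cons (a : Bool) :
    TM2.step program (config (some .check) 0 x y (a :: u) r c o) =
      some (config (some (bif a then .clear else .check)) 0 x y u r c o) := by
  cases a <;> simp [config, program, checkCode, update_undominated, contents, idle]

theorem step_check_nil :
    TM2.step program (config (some .check) 0 x y [] r c o) =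
      some (config none 0 x y [] r c (true :: o)) := by
  simp [config, program, checkCode, update_undominated, update_output, contents, idle]

theorem step_clear (h : u ≠ [] ∨ o ≠ []) :
    TM2.step program (config (some .clear) 0 x y u r c o) =
      some (config (some .clear) 0 x y u.tail r c o.tail) := by
  have : (u.head?.isSome || o.head?.isSome) = true := by
    simpa [List.isSome_head?] using h
  simp [config, program, clearCode, update_undominated, update_output, contents, idle, this]

theorem step_clear_nil :
    TM2.step program (config (some .clear) 0 x y [] r c []) =
      some (config none 0 x y [] r c [false]) := by
  simp [config, program, clearCode, update_undominated, update_output, contents, idle]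

end Steps

/-! ### Loops of the machine: one row, the final check, the clearing. -/

section Loops

variable {α : Type*} (a b : α → Bool)

@[simp]
theorem saturate_zero : saturate 0 = 0 := rfl

/-- Truncating at 2 commutes with incrementing, and thresholds 1 and 2 cannot see the truncation. -/
theorem bump_saturate (k : ℕ) (p : Bool) :
    (bif p then saturate ((saturate k).val + 1) else saturate k) =
      saturate (k + bif p then 1 else 0) := by
  cases p
  · rfl
  · simp only [cond_true, saturate, Fin.mk.injEq]
    omega

theorem reaches_saturate (second : Bool) (k : ℕ) :
    reaches second (saturate k) = decide ((bif second then 1 else 2) ≤ k) := by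
  cases second <;> simp [reaches, saturate]

/-- The stack `w` holds the values of `a` on the list `l`; it may be empty if they are all true. -/
def Represents (w : List Bool) (l : List α) : Prop :=
  w = l.map a ∨ w = [] ∧ ∀ v ∈ l, a v = true

variable {a} in
theorem Represents.head {w : List Bool} {l : List α} {v : α} (h : Represents a w (v :: l)) :
    w.head?.getD true = a v := by
  rcases h with rfl | ⟨rfl, h⟩
  · simp
  · simp [h v]

variable {a} in
theorem Represents.tail {w : List Bool} {l : List α} {v : α} (h : Represents a w (v :: l)) :
    Represents a w.tail l := by
  rcases h with rfl | ⟨rfl, h⟩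
  · exact .inl rfl
  · exact .inr ⟨rfl, fun v hv => h v (List.mem_cons_of_mem _ hv)⟩

theorem runs_scan (second : Bool) (l : List α) (k : ℕ) (x y : List (Option Bool)) (w : List Bool)
    (hw : Represents a w l) (r : List (Bool × Bool)) (c o : List Bool) :
    Runs l.length
      (passConfig second (.scan second) (saturate k) (l.map (fun v => some (b v)) ++ x) y w r c o)
      (passConfig second (.scan second) (saturate (k + l.countP fun v => b v && a v)) x y []
        ((l.map fun v => (b v, a v)).reverse ++ r) c o) := by
  induction l generalizing k w r with
  | nil =>
    have : w = [] := by rcases hw with h | h <;> simp [h]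
    subst this
    exact Runs.refl _
  | cons v l ih =>
    refine Runs.head (step_scan_entry _ _ _ _ _ _ _ _ _) ?_
    rw [hw.head, bump_saturate]
    have := ih (k + bif b v && a v then 1 else 0) _ hw.tail ((b v, a v) :: r)
    have hcount : (k + bif b v && a v then 1 else 0) + l.countP (fun v => b v && a v) =
        k + (v :: l).countP fun v => b v && a v := by
      rw [List.countP_cons]
      cases b v <;> cases a v <;> simp only [Bool.and_true, Bool.and_false, cond_true,
        cond_false, if_true, Bool.false_eq_true, if_false] <;> omega
    rw [hcount] at this
    simpa using this

theorem runs_unwind (second : Bool) (k : Fin 3) (l : List α) (x y : List (Option Bool))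
    (u : List Bool) (c o : List Bool) :
    Runs l.length
      (passConfig second (.unwind second) k x y u (l.map fun v => (b v, a v)) c o)
      (passConfig second (.unwind second) k x
        (bif second then y else (l.map fun v => some (b v)).reverse ++ y)
        ((l.map fun v => a v && !(b v && reaches second k)).reverse ++ u) [] c o) := by
  induction l generalizing y u with
  | nil => cases second <;> exact Runs.refl _
  | cons v l ih =>
    refine Runs.head (step_unwind_cons _ _ _ _ _ _ _ _ _ _) ?_
    convert ih _ _ using 2
    · cases second <;> simp
    · simp

theorem runs_row_first (l : List α) (x y : List (Option Bool)) (w : List Bool)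
    (hw : Represents a w l) (c o : List Bool) :
    Runs (2 * l.length + 2)
      (passConfig false (.scan false) 0 (l.map (fun v => some (b v)) ++ none :: x) y w [] c o)
      (passConfig false (.scan false) 0 x (l.map (fun v => some (b v)) ++ none :: y)
        (l.map fun v => a v && !(b v && decide (2 ≤ l.countP fun v => b v && a v))) []
        (decide (2 ≤ l.countP fun v => b v && a v) :: c) o) := by
  have h1 := runs_scan a b false l 0 (none :: x) y w hw [] c o
  have h2 := Runs.of_step (step_scan_marker_first x y [] ((l.map fun v => (b v, a v)).reverse ++ [])
    c o (saturate (0 + l.countP fun v => b v && a v)))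
  -- The scan left the row reversed on its stack, so unwinding along `l.reverse` restores the
  -- original order, both of the vector and of the saved row above its marker.
  have h3 := runs_unwind a b false (saturate (0 + l.countP fun v => b v && a v)) l.reverse x
    (none :: y) [] c o
  have h4 := (h1.trans h2).trans (by
    rw [List.append_nil, ← List.map_reverse]
    exact h3.trans (Runs.of_step (step_unwind_nil _ _ _ _ _ _ _)))
  have htime : l.length + 1 + (l.reverse.length + 1) = 2 * l.length + 2 := by
    rw [List.length_reverse]
    omega
  rw [htime] at h4
  simpa [reaches_saturate, List.map_reverse] using h4

theorem runs_row_second (l : List α) (x y : List (Option Bool)) (w : List Bool)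
    (hw : Represents a w l) (d : Bool) (c o : List Bool) :
    Runs (2 * l.length + 2)
      (passConfig true (.scan true) 0 (l.map (fun v => some (b v)) ++ none :: x) y w [] (d :: c) o)
      (passConfig true (.scan true) 0 x y
        (l.map fun v => a v && !(b v && decide (1 ≤ l.countP fun v => b v && a v))) [] c
        ((!(d || decide (1 ≤ l.countP fun v => b v && a v))) :: o)) := by
  have h1 := runs_scan a b true l 0 (none :: x) y w hw [] (d :: c) o
  have h2 := Runs.of_step (step_scan_marker_second x y []
    ((l.map fun v => (b v, a v)).reverse ++ []) c o
    (saturate (0 + l.countP fun v => b v && a v)) d)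
  have h3 := runs_unwind a b true (saturate (0 + l.countP fun v => b v && a v)) l.reverse x
    y [] c ((!(d || reaches true (saturate (0 + l.countP fun v => b v && a v)))) :: o)
  have h4 := (h1.trans h2).trans (by
    rw [List.append_nil, ← List.map_reverse]
    exact h3.trans (Runs.of_step (step_unwind_nil _ _ _ _ _ _ _)))
  have htime : l.length + 1 + (l.reverse.length + 1) = 2 * l.length + 2 := by
    rw [List.length_reverse]
    omega
  rw [htime] at h4
  simpa [reaches_saturate, List.map_reverse] using h4

theorem runs_clear (x y : List (Option Bool)) (u : List Bool) (r : List (Bool × Bool))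
    (c o : List Bool) :
    ∃ t ≤ u.length + o.length + 1,
      Runs t (config (some .clear) 0 x y u r c o) (config none 0 x y [] r c [false]) := by
  induction hn : u.length + o.length using Nat.strong_induction_on generalizing u o with
  | _ n ih =>
    by_cases h : u ≠ [] ∨ o ≠ []
    · have hlt : u.tail.length + o.tail.length < n := by
        simp only [← List.length_pos_iff] at h
        simp only [List.length_tail]
        omega
      obtain ⟨t, ht, hrun⟩ := ih _ hlt u.tail o.tail rfl
      exact ⟨t + 1, by omega, hrun.head (step_clear x y u r c o h)⟩
    · push Not at h
      obtain ⟨rfl, rfl⟩ := h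
      exact ⟨1, by omega, .of_step (step_clear_nil _ _ _ _)⟩

theorem runs_check (x y : List (Option Bool)) (u : List Bool) (r : List (Bool × Bool))
    (c o : List Bool) :
    ∃ t ≤ u.length + o.length + 2,
      Runs t (config (some .check) 0 x y u r c o)
        (config none 0 x y [] r c (bif u.any id then [false] else true :: o)) := by
  induction u with
  | nil => exact ⟨1, by omega, .of_step (step_check_nil _ _ _ _ _)⟩
  | cons p u ih =>
    have hstep := step_check_cons x y u r c o p
    cases p
    · obtain ⟨t, ht, h⟩ := ih
      exact ⟨t + 1, by simp only [List.length_cons]; omega, by simpa using h.head hstep⟩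
    · obtain ⟨t, ht, h⟩ := runs_clear x y u r c o
      exact ⟨t + 1, by simp only [List.length_cons]; omega, by simpa using h.head hstep⟩

end Loops

end GreedyMachine

/-! ### The machine on adjacency matrices -/

namespace SimpleGraph

/-! ### Membership in the greedy state, vertex by vertex. -/

section Greedy

variable {V : Type*} [DecidableEq V] {G : SimpleGraph V}

theorem mem_greedyStep_snd_of_ne {t : ℕ} {S : Finset V × Finset V} {v w : V} (h : w ≠ v) :
    w ∈ (G.greedyStep t S v).2 ↔ w ∈ S.2 := by
  unfold greedyStep
  split_ifs <;> simp [h]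

/-- Whether a vertex is chosen changes only at its own turn. Hence a bit written at that turn is
already the final one. -/
theorem mem_greedyPass_snd_of_notMem {t : ℕ} {S : Finset V × Finset V} {l : List V} {w : V}
    (h : w ∉ l) : w ∈ (G.greedyPass t S l).2 ↔ w ∈ S.2 := by
  induction l generalizing S with
  | nil => exact Iff.rfl
  | cons v l ih =>
    rw [List.mem_cons, not_or] at h
    exact (ih h.2).trans (mem_greedyStep_snd_of_ne h.1)

theorem mem_greedyStep_snd_self {t : ℕ} {S : Finset V × Finset V} {v : V} :
    v ∈ (G.greedyStep t S v).2 ↔ v ∈ S.2 ∨ t ≤ (G.openNeighbors S.1 v).card := by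
  unfold greedyStep
  split_ifs with h <;> simp [h]

theorem mem_greedyStep_fst {t : ℕ} {S : Finset V × Finset V} {v w : V} :
    w ∈ (G.greedyStep t S v).1 ↔
      w ∈ S.1 ∧ ¬ (G.Adj v w ∧ t ≤ (G.openNeighbors S.1 v).card) := by
  unfold greedyStep
  split_ifs with h
  · simp only [Finset.mem_sdiff, mem_openNeighbors]
    tauto
  · simp [h]

end Greedy

open scoped Classical in
theorem card_openNeighbors_eq_countP {n : ℕ} (G : SimpleGraph (Fin n)) (U : Finset (Fin n))
    (v : Fin n) :
    (G.openNeighbors U v).card =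
      (List.finRange n).countP fun w => decide (G.Adj v w) && decide (w ∈ U) := by
  rw [List.countP_eq_length_filter, ← List.toFinset_card_of_nodup
    ((List.nodup_finRange n).filter _)]
  congr 1
  ext w
  simp [mem_openNeighbors, and_comm]

end SimpleGraph

/-! ### Simulation of the greedy passes by the machine. -/

namespace GreedyMachine

open Turing

variable (G : FinGraph)

/-- The characteristic vector of a state's first component may be missing if the set is full. -/
def Holds (w : List Bool) (U : Finset (Fin G.1)) : Prop :=
  Represents (fun v => decide (v ∈ U)) w (List.finRange G.1)

/-- The machine records only the threshold test; this is membership after the step because `v` was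
not chosen before. -/
theorem runs_vertex_first (S : Finset (Fin G.1) × Finset (Fin G.1)) (v : Fin G.1)
    (hv : v ∉ S.2) (x y : List (Option Bool)) (w : List Bool) (hw : Holds G w S.1)
    (c o : List Bool) :
    Runs (2 * G.1 + 2)
      (passConfig false (.scan false) 0 (G.encodeRow v ++ x) y w [] c o)
      (passConfig false (.scan false) 0 x (G.encodeRow v ++ y)
        (encodeVertexSet (G.2.greedyStep 2 S v).1) []
        (decide (v ∈ (G.2.greedyStep 2 S v).2) :: c) o) := by
  classical
  have h := runs_row_first _ (fun z => decide (G.2.Adj v z)) (List.finRange G.1) x y w hw c o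
  rw [← SimpleGraph.card_openNeighbors_eq_countP, List.length_finRange] at h
  have h1 : decide (v ∈ (G.2.greedyStep 2 S v).2) =
      decide (2 ≤ (G.2.openNeighbors S.1 v).card) := by
    simp [SimpleGraph.mem_greedyStep_snd_self, hv]
  have h2 : encodeVertexSet (G.2.greedyStep 2 S v).1 = (List.finRange G.1).map fun z =>
      decide (z ∈ S.1) && !(decide (G.2.Adj v z) &&
        decide (2 ≤ (G.2.openNeighbors S.1 v).card)) := by
    refine List.map_congr_left fun z _ => ?_
    rw [← Bool.decide_and, ← decide_not, ← Bool.decide_and]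
    exact decide_eq_decide.2 SimpleGraph.mem_greedyStep_fst
  rw [h1, h2, FinGraph.encodeRow, List.append_assoc, List.append_assoc]
  exact h

theorem runs_vertex_second (S : Finset (Fin G.1) × Finset (Fin G.1)) (v : Fin G.1)
    (x y : List (Option Bool)) (w : List Bool) (hw : Holds G w S.1) (c o : List Bool) :
    Runs (2 * G.1 + 2)
      (passConfig true (.scan true) 0 (G.encodeRow v ++ x) y w [] (decide (v ∈ S.2) :: c) o)
      (passConfig true (.scan true) 0 x y
        (encodeVertexSet (G.2.greedyStep 1 S v).1) [] c
        ((!decide (v ∈ (G.2.greedyStep 1 S v).2)) :: o)) := by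
  classical
  have h := runs_row_second _ (fun z => decide (G.2.Adj v z)) (List.finRange G.1) x y w hw
    (decide (v ∈ S.2)) c o
  rw [← SimpleGraph.card_openNeighbors_eq_countP, List.length_finRange] at h
  have h1 : decide (v ∈ (G.2.greedyStep 1 S v).2) =
      (decide (v ∈ S.2) || decide (1 ≤ (G.2.openNeighbors S.1 v).card)) := by
    rw [← Bool.decide_or]
    exact decide_eq_decide.2 SimpleGraph.mem_greedyStep_snd_self
  have h2 : encodeVertexSet (G.2.greedyStep 1 S v).1 = (List.finRange G.1).map fun z =>
      decide (z ∈ S.1) && !(decide (G.2.Adj v z) &&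
        decide (1 ≤ (G.2.openNeighbors S.1 v).card)) := by
    refine List.map_congr_left fun z _ => ?_
    rw [← Bool.decide_and, ← decide_not, ← Bool.decide_and]
    exact decide_eq_decide.2 SimpleGraph.mem_greedyStep_fst
  rw [h1, h2, FinGraph.encodeRow, List.append_assoc]
  exact h

variable {G} in
theorem holds_encodeVertexSet (U : Finset (Fin G.1)) : Holds G (encodeVertexSet U) U := .inl rfl

/-- Rows and choices pile up in reverse, ready for a second pass along `l.reverse`. Distinctness of
the listed vertices keeps each one unchosen until its turn and its bit unchanged afterwards. -/
theorem runs_first_pass (l : List (Fin G.1)) (hl : l.Nodup)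
    (S : Finset (Fin G.1) × Finset (Fin G.1)) (hS : ∀ v ∈ l, v ∉ S.2) (x y : List (Option Bool))
    (w : List Bool) (hw : Holds G w S.1) (c o : List Bool) :
    ∃ w', Holds G w' (G.2.greedyPass 2 S l).1 ∧
      Runs (l.length * (2 * G.1 + 2))
        (passConfig false (.scan false) 0 (l.flatMap G.encodeRow ++ x) y w [] c o)
        (passConfig false (.scan false) 0 x (l.reverse.flatMap G.encodeRow ++ y) w' []
          (l.reverse.map (fun v => decide (v ∈ (G.2.greedyPass 2 S l).2)) ++ c) o) := by
  induction l generalizing S w y c with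
  | nil => exact ⟨w, hw, by simpa using Runs.refl _⟩
  | cons v l ih =>
    obtain ⟨hv, hl⟩ := List.nodup_cons.1 hl
    obtain ⟨w', hw', h⟩ := ih hl (G.2.greedyStep 2 S v)
      (fun z hz => by
        have hne : z ≠ v := fun h => hv (h ▸ hz)
        rw [SimpleGraph.mem_greedyStep_snd_of_ne hne]
        exact hS z (List.mem_cons_of_mem _ hz))
      (G.encodeRow v ++ y) _ (holds_encodeVertexSet _)
      (decide (v ∈ (G.2.greedyStep 2 S v).2) :: c)
    refine ⟨w', hw', ?_⟩
    have h1 := (runs_vertex_first G S v (hS v List.mem_cons_self) (l.flatMap G.encodeRow ++ x) y w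
      hw c o).trans h
    have h2 : decide (v ∈ (G.2.greedyStep 2 S v).2) =
        decide (v ∈ (G.2.greedyPass 2 (G.2.greedyStep 2 S v) l).2) :=
      decide_eq_decide.2 (SimpleGraph.mem_greedyPass_snd_of_notMem hv).symm
    rw [h2] at h1
    have htime : 2 * G.1 + 2 + l.length * (2 * G.1 + 2) = (v :: l).length * (2 * G.1 + 2) := by
      rw [List.length_cons]
      ring
    rw [htime] at h1
    simp only [List.flatMap_cons, List.reverse_cons, List.flatMap_append, List.flatMap_nil,
      List.map_append, List.map_cons, List.map_nil, List.append_assoc, List.cons_append,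
      List.nil_append, List.append_nil]
    exact h1

/-- Any treated row rewrites the whole vector, so the final stack is explicit even if the initial
one was empty as a stand-in for the full set; only for empty `l` must this be assumed. -/
theorem runs_second_pass (l : List (Fin G.1)) (hl : l.Nodup)
    (S : Finset (Fin G.1) × Finset (Fin G.1)) (x y : List (Option Bool))
    (w : List Bool) (hw : Holds G w S.1) (c o : List Bool) :
    ∃ w', (l ≠ [] ∨ w = encodeVertexSet S.1 → w' = encodeVertexSet (G.2.greedyPass 1 S l).1) ∧
      Runs (l.length * (2 * G.1 + 2))
        (passConfig true (.scan true) 0 (l.flatMap G.encodeRow ++ x) y w []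
          (l.map (fun v => decide (v ∈ S.2)) ++ c) o)
        (passConfig true (.scan true) 0 x y w' [] c
          (l.reverse.map (fun v => !decide (v ∈ (G.2.greedyPass 1 S l).2)) ++ o)) := by
  induction l generalizing S w o with
  | nil => exact ⟨w, by simp, by simpa using Runs.refl _⟩
  | cons v l ih =>
    obtain ⟨hv, hl⟩ := List.nodup_cons.1 hl
    obtain ⟨w', hw', h⟩ := ih hl (G.2.greedyStep 1 S v) _ (holds_encodeVertexSet _)
      ((!decide (v ∈ (G.2.greedyStep 1 S v).2)) :: o)
    -- The `chosen` stack still holds first-pass bits; treating `v` does not alter those of the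
    -- later vertices.
    have hmap : l.map (fun z => decide (z ∈ (G.2.greedyStep 1 S v).2)) =
        l.map fun z => decide (z ∈ S.2) :=
      List.map_congr_left fun z hz => decide_eq_decide.2
        (SimpleGraph.mem_greedyStep_snd_of_ne fun h => hv (h ▸ hz))
    rw [hmap] at h
    have h1 := (runs_vertex_second G S v (l.flatMap G.encodeRow ++ x) y w hw _ o).trans h
    have h2 : decide (v ∈ (G.2.greedyStep 1 S v).2) =
        decide (v ∈ (G.2.greedyPass 1 (G.2.greedyStep 1 S v) l).2) :=
      decide_eq_decide.2 (SimpleGraph.mem_greedyPass_snd_of_notMem hv).symm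
    rw [h2] at h1
    have htime : 2 * G.1 + 2 + l.length * (2 * G.1 + 2) = (v :: l).length * (2 * G.1 + 2) := by
      rw [List.length_cons]
      ring
    rw [htime] at h1
    refine ⟨w', fun _ => hw' (.inr rfl), ?_⟩
    simp only [List.flatMap_cons, List.reverse_cons, List.map_append, List.map_cons, List.map_nil,
      List.append_assoc, List.cons_append, List.nil_append]
    exact h1

theorem runs_greedy :
    ∃ t ≤ 6 * G.encode.length + 4,
      Runs t (config (some (.scan false)) 0 G.encode [] [] [] [] [])
        (config none 0 [] [] [] [] [] (harmlessSetCoding.encAnswer G G.2.greedyAnswer)) := by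
  obtain ⟨w, hw, h1⟩ := runs_first_pass G (List.finRange G.1) (List.nodup_finRange _)
    (Finset.univ, ∅) (by simp) [] [] [] (.inr ⟨rfl, by simp⟩) [] []
  obtain ⟨w', hw', h2⟩ := runs_second_pass G (List.finRange G.1).reverse
    (List.nodup_reverse.2 (List.nodup_finRange _)) G.2.greedyFirst [] [] w hw [] []
  have hw'' : w' = encodeVertexSet G.2.greedyResult.1 := by
    refine hw' ?_
    -- For the graph without vertices, the empty stack is itself the characteristic vector.
    by_cases h : List.finRange G.1 = []
    · right
      rcases hw with hw | hw
      · exact hw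
      · rw [hw.1, encodeVertexSet, h, List.map_nil]
    · left
      simpa using h
  obtain ⟨t, ht, h3⟩ := runs_check [] [] w' [] []
    ((List.finRange G.1).map fun v => !decide (v ∈ G.2.greedyResult.2))
  rw [List.reverse_reverse, List.append_nil, List.append_nil, List.append_nil] at h2
  rw [List.append_nil, List.append_nil, List.append_nil] at h1
  have h12 := h1.trans (.head (step_scan_nil_first _ _ _ _ _) h2)
  have h23 := h12.trans (.head (step_scan_nil_second _ _ _ _ _) h3)
  have hanswer : harmlessSetCoding.encAnswer G G.2.greedyAnswer = bif w'.any id then [false] else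
      true :: (List.finRange G.1).map fun v => !decide (v ∈ G.2.greedyResult.2) := by
    -- A `true` bit is present exactly when the undominated set is nonempty.
    have hany : w'.any id = !decide (G.2.greedyResult.1 = ∅) := by
      rw [hw'', Bool.eq_iff_iff]
      simp [encodeVertexSet, Finset.eq_empty_iff_forall_notMem]
    rw [hany, SimpleGraph.greedyAnswer]
    by_cases h : G.2.greedyResult.1 = ∅
    · simp [h, MaxProblem.Coding.encAnswer, harmlessSetCoding, encodeVertexSet]
    · simp [h, MaxProblem.Coding.encAnswer]
  rw [hanswer]
  refine ⟨_, ?_, h23⟩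
  have hlen : w'.length = G.1 := by simp [hw'', encodeVertexSet]
  have hsq : G.1 ≤ G.1 * (G.1 + 1) := Nat.le_mul_of_pos_right _ (Nat.succ_pos _)
  simp only [List.length_map, List.length_finRange, List.length_reverse, hlen] at ht ⊢
  rw [FinGraph.encode_length]
  -- With input length `L = n(n + 1)`, each pass takes `2L` steps, the two changes of phase take 2,
  -- and the check takes at most `2n + 2 ≤ 2L + 2`: in total at most `6L + 4`.
  have : G.1 * (2 * G.1 + 2) = 2 * (G.1 * (G.1 + 1)) := by ring
  omega

theorem initList_machine (l : List (Option Bool)) :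
    initList machine l = config (some (.scan false)) 0 l [] [] [] [] [] := by
  unfold initList config
  congr 1
  funext k
  cases k <;> rfl

theorem haltList_machine (l : List Bool) :
    haltList machine l = config none 0 [] [] [] [] [] l := by
  unfold haltList config
  congr 1
  funext k
  cases k <;> rfl

theorem machine_outputs :
    ∃ t ≤ 6 * G.encode.length + 4,
      (flip bind machine.step)^[t]
        (some (initList machine (G.encode.map (Equiv.refl (Option Bool)).invFun))) =
      some (haltList machine ((harmlessSetCoding.encAnswer G G.2.greedyAnswer).map
        (Equiv.refl Bool).invFun)) := by
  have hi : initList machine (G.encode.map (Equiv.refl (Option Bool)).invFun) = _ :=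
    (congrArg (initList machine) (List.map_id _)).trans (initList_machine G.encode)
  have ho : haltList machine ((harmlessSetCoding.encAnswer G G.2.greedyAnswer).map
      (Equiv.refl Bool).invFun) = _ :=
    (congrArg (haltList machine) (List.map_id _)).trans (haltList_machine _)
  rw [hi, ho]
  exact runs_greedy G

/-- The machine computes the answers of the greedy algorithm in polynomial time. -/
noncomputable def greedyComputable :
    TM2ComputableInPolyTime harmlessSetCoding.encInst (id : List Bool → List Bool)
      (fun G => harmlessSetCoding.encAnswer G G.2.greedyAnswer) where
  tm := machine
  inputAlphabet := Equiv.refl (Option Bool)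
  outputAlphabet := Equiv.refl Bool
  time := 6 * Polynomial.X + 4
  outputsFun G :=
    { steps := (machine_outputs G).choose
      evals_in_steps := (machine_outputs G).choose_spec.2
      steps_le_m := (machine_outputs G).choose_spec.1.trans_eq (by simp; rfl) }

end GreedyMachine

theorem mainTheorem1 :
    harmlessSetProblem.PolyTimeApproximable harmlessSetCoding 2 := by
  exact ⟨fun G => G.2.greedyAnswer, isApproxSolution_greedyAnswer, greedyAnswer_eq_none,
    ⟨GreedyMachine.greedyComputable⟩⟩
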